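/- Let $A$ be an alphabet (a finite nonempty set) and $K$ a commutative semiring. Series are maps $s:A^*\to K$; for $w=w(0)\ldots w(n-1)$ and $0\le i\le n$ let $w_{\ge i}=w(i)\ldots w(n-1)$ (so $w_{\ge n}=\varepsilon$). A series $s$ is proper if $s(\varepsilon)=0$. For each $a\in A$ let $p_a$ be an atomic proposition, with $w\models p_a$ iff $w\ne\varepsilon$ and $w(0)=a$. Boolean connectives and $true$ have their usual meaning. **LDL.** Formulas: $\psi::=true\mid p_a\mid\neg\psi\mid\psi\wedge\psi\mid\langle\theta\rangle\psi$ and $\theta::=\phi\mid\psi?\mid\theta+\theta\mid\theta;\theta\mid\theta^+$, where $\phi$ is a propositional formula over the $p_a$. Semantics: $w\models\langle\phi\rangle\psi$ iff $w\neq\varepsilon$, $w\models\phi$ and $w_{\ge1}\models\psi$; $w\models\langle\psi_1?\rangle\psi_2$ iff $w\models\psi_1$ and $w\models\psi_2$; $w\models\langle\theta_1+\theta_2\rangle\psi$ iff $w\models\langle\theta_1\rangle\psi$ or $w\models\langle\theta_2\rangle\psi$; $w\models\langle\theta_1;\theta_2\rangle\psi$ iff $w=uv$ with $u\models\langle\theta_1\rangle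 true$ and $v\models\langle\theta_2\rangle\psi$; $w\models\langle\theta^+\rangle\psi$ iff $w\models\langle\theta^n\rangle\psi$ for some $1\le n\le|w|$, where $\theta^1=\theta$ and $\theta^{n}=\theta^{n-1};\theta$. **Weighted LDL.** Formulas: $\varphi::=k\mid\psi\mid\varphi\oplus\varphi\mid\varphi\otimes\varphi\mid\langle\rho\rangle\varphi$ and $\rho::=\phi\mid\varphi?\mid\rho\oplus\rho\mid\rho\cdot\rho\mid\rho^{\oplus}$, with $k\in K$, $\psi$ an LDL formula, $\phi$ propositional. Semantics $\|\varphi\|:A^*\to K$: $\|k\|(w)=k$; $\|\psi\|(w)=1$ if $w\models\psi$ and $0$ otherwise; $\oplus$ and $\otimes$ are pointwise sum and product; $\|\langle\phi\rangle\varphi\|(w)=\|\phi\|(w)\cdot\|\varphi\|(w_{\ge1})$ for $w\ne\varepsilon$ and $0$ for $w=\varepsilon$; $\|\langle\varphi_1?\rangle\varphi_2\|=\|\varphi_1\|\cdot\|\varphi_2\|$ pointwise; $\|\langle\rho_1\oplus\rho_2\rangle\varphi\|=\|\langle\rho_1\rangle\varphi\|+\|\langle\rho_2\rangle\varphi\|$;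 $\|\langle\rho_1\cdot\rho_2\rangle\varphi\|(w)=\sum_{w=uv}\|\langle\rho_1\rangle true\|(u)\cdot\|\langle\rho_2\rangle\varphi\|(v)$; $\|\langle\rho^\oplus\rangle\varphi\|(w)=\sum_{n\ge1}\|\langle\rho^n\rangle\varphi\|(w)$, where $\rho^1=\rho$, $\rho^n=\rho^{n-1}\cdot\rho$, defined only if $\|\langle\rho\rangle true\|$ is proper (the sum is then finite). A series is *LDL-definable* if it equals $\|\varphi\|$ for some weighted LDL formula $\varphi$ whose semantics is defined. **Weighted LTL.** LTL formulas $\phi::=true\mid p_a\mid\neg\phi\mid\phi\vee\phi\mid\bigcirc\phi\mid\phi\,U\,\phi$ have the usual semantics $w,i\models\phi$ on the positions $0,\dots,|w|-1$ of a finite word ($\bigcirc\phi$ holds at $i$ iff $i+1<|w|$ and $\phi$ holds at $i+1$), and $w\models\phi$ means $w,0\models\phi$; on $\varepsilon$, atoms, $\bigcirc\phi$ and $\phi\,U\,\phi'$ are false. Weighted LTL formulas are $\varphi::=k\mid\phi\mid\varphi\oplus\varphi\mid\varphi\otimes\varphi\mid\bigcirc\varphi\mid\varphi\,\mathcal U\,\varphi\mid\boxtimes\varphi$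 with $k\in K$ and $\phi$ an LTL formula. The semantics of $k,\phi,\oplus,\otimes$ is as above; for $|w|=n$, $\|\bigcirc\varphi\|(w)=\|\varphi\|(w_{\ge1})$ if $n\ge1$ and $0$ if $n=0$; $\|\boxtimes\varphi\|(w)=\prod_{0\le i\le n-1}\|\varphi\|(w_{\ge i})$; $\|\varphi\,\mathcal U\,\psi\|(w)=\sum_{0\le i\le n-1}\bigl(\prod_{0\le j<i}\|\varphi\|(w_{\ge j})\bigr)\cdot\|\psi\|(w_{\ge i})$. An *LTL-step formula* is a formula $\bigoplus_{1\le i\le m}(k_i\otimes\phi_i)$, $m\ge1$, with $k_i\in K$ and LTL formulas $\phi_i$. A weighted LTL formula is *restricted* if, whenever it contains a subformula $\boxtimes\psi$ or $\psi\,\mathcal U\,\xi$, the formula $\psi$ is an LTL-step formula. A series is *rLTL-definable* if it equals $\|\varphi\|$ for some restricted weighted LTL formula $\varphi$. **Theorem.** Every rLTL-definable series $s:A^*\to K$ is LDL-definable. -/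

import Mathlib

namespace WeightedLogic

universe u v

/-! ### Propositional formulas and classical linear dynamic logic over an alphabet `A` -/

/-- Propositional formulas over the atomic propositions `p_a`, `a ∈ A`. -/
inductive PropFormula (A : Type*) where
  | tt : PropFormula A
  | atom : A → PropFormula A
  | neg : PropFormula A → PropFormula A
  | and : PropFormula A → PropFormula A → PropFormula A

/-- Satisfaction `w ⊨ φ`; `p_a` says that the first letter exists and is `a`. -/
def PropFormula.Sat {A : Type*} : PropFormula A → List A → Prop
  | .tt, _ => True
  | .atom a, w => w.head? = some a
  | .neg φ, w => ¬ φ.Sat w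
  | .and φ χ, w => φ.Sat w ∧ χ.Sat w

mutual
  /-- LDL formulas `ψ ::= true ∣ p_a ∣ ¬ψ ∣ ψ ∧ ψ ∣ ⟨θ⟩ψ`. -/
  inductive LDL (A : Type u) where
    | tt : LDL A
    | atom : A → LDL A
    | neg : LDL A → LDL A
    | and : LDL A → LDL A → LDL A
    | dia : LDLPath A → LDL A → LDL A
  /-- LDL path expressions `θ ::= φ ∣ ψ? ∣ θ + θ ∣ θ;θ ∣ θ⁺`, `φ` propositional. -/
  inductive LDLPath (A : Type u) where
    | prop : PropFormula A → LDLPath A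
    | test : LDL A → LDLPath A
    | add : LDLPath A → LDLPath A → LDLPath A
    | seq : LDLPath A → LDLPath A → LDLPath A
    | plus : LDLPath A → LDLPath A
end

/-- The syntactic powers of a path expression: `θ.pow n` is `θⁿ⁺¹`, that is, `θ¹ = θ` and
`θⁿ⁺¹ = θⁿ;θ`. -/
def LDLPath.pow {A : Type*} (θ : LDLPath A) : ℕ → LDLPath A
  | 0 => θ
  | n + 1 => .seq (θ.pow n) θ

/-- If `D₁`, `D₂` are the meanings of `⟨θ₁⟩`, `⟨θ₂⟩`, this is the meaning of `⟨θ₁;θ₂⟩`: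
`w = uv` with `u ⊨ ⟨θ₁⟩true` and `v ⊨ ⟨θ₂⟩ψ`. -/
def seqSat {A : Type*} (D₁ D₂ : (List A → Prop) → List A → Prop) (S : List A → Prop)
    (w : List A) : Prop :=
  ∃ u v, w = u ++ v ∧ D₁ (fun _ => True) u ∧ D₂ S v

/-- If `D` is the meaning of `⟨θ⟩`, then `powSat D n` is the meaning of `⟨θⁿ⁺¹⟩`. -/
def powSat {A : Type*} (D : (List A → Prop) → List A → Prop) :
    ℕ → (List A → Prop) → List A → Prop
  | 0 => D
  | n + 1 => seqSat (powSat D n) D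

mutual
  /-- Satisfaction `w ⊨ ψ` for LDL formulas on finite words. -/
  def LDL.Sat {A : Type u} : LDL A → List A → Prop
    | .tt => fun _ => True
    | .atom a => fun w => w.head? = some a
    | .neg ψ => fun w => ¬ ψ.Sat w
    | .and ψ χ => fun w => ψ.Sat w ∧ χ.Sat w
    | .dia θ ψ => θ.DiaSat ψ.Sat
  /-- `θ.DiaSat S w` says `w ⊨ ⟨θ⟩ψ`, where `S` is the set of words satisfying `ψ`. For a
  propositional `φ`, `⟨φ⟩ψ` reads one letter, so it fails on the empty word. -/
  def LDLPath.DiaSat {A : Type u} : LDLPath A → (List A → Prop) → List A → Prop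
    | .prop φ => fun S w => φ.Sat w ∧ ∃ a v, w = a :: v ∧ S v
    | .test ψ => fun S w => ψ.Sat w ∧ S w
    | .add θ₁ θ₂ => fun S w => θ₁.DiaSat S w ∨ θ₂.DiaSat S w
    | .seq θ₁ θ₂ => seqSat θ₁.DiaSat θ₂.DiaSat
    | .plus θ => fun S w => ∃ n, n + 1 ≤ w.length ∧ powSat θ.DiaSat n S w
end

theorem LDLPath.diaSat_pow {A : Type*} (θ : LDLPath A) (n : ℕ) :
    (θ.pow n).DiaSat = powSat θ.DiaSat n := by
  induction n with
  | zero => rfl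
  | succ n ih => rw [LDLPath.pow, LDLPath.DiaSat, ih, powSat]

/-- The defining clause of `θ⁺`: `1 ≤ n ≤ |w|` and `w ⊨ ⟨θⁿ⟩ψ` for some `n`. -/
theorem LDL.sat_dia_plus {A : Type*} (θ : LDLPath A) (ψ : LDL A) (w : List A) :
    (LDL.dia (.plus θ) ψ).Sat w ↔
      ∃ n, n + 1 ≤ w.length ∧ (LDL.dia (θ.pow n) ψ).Sat w := by
  simp only [LDL.Sat, LDLPath.DiaSat, LDLPath.diaSat_pow]

/-! ### Weighted linear dynamic logic -/

mutual
  /-- Weighted LDL formulas `φ ::= k ∣ ψ ∣ φ ⊕ φ ∣ φ ⊗ φ ∣ ⟨ρ⟩φ`, `ψ` an LDL formula. -/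
  inductive WLDL (K : Type v) (A : Type u) where
    | const : K → WLDL K A
    | ldl : LDL A → WLDL K A
    | add : WLDL K A → WLDL K A → WLDL K A
    | mul : WLDL K A → WLDL K A → WLDL K A
    | dia : WPath K A → WLDL K A → WLDL K A
  /-- Weighted path expressions `ρ ::= φ ∣ φ? ∣ ρ ⊕ ρ ∣ ρ · ρ ∣ ρ^⊕`; in the first case `φ` is
  propositional, in the second a weighted LDL formula. -/
  inductive WPath (K : Type v) (A : Type u) where
    | prop : PropFormula A → WPath K A
    | test : WLDL K A → WPath K A
    | add : WPath K A → WPath K A → WPath K A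
    | cat : WPath K A → WPath K A → WPath K A
    | plus : WPath K A → WPath K A
end

/-- The syntactic powers of a weighted path expression: `ρ.pow n` is `ρⁿ⁺¹`, that is, `ρ¹ = ρ`
and `ρⁿ⁺¹ = ρⁿ · ρ`. -/
def WPath.pow {K A : Type*} (ρ : WPath K A) : ℕ → WPath K A
  | 0 => ρ
  | n + 1 => .cat (ρ.pow n) ρ

/-- The Cauchy product of series, `(s · r)(w) = ∑_{w = uv} s(u) r(v)`. -/
def cauchy {A K : Type*} [Semiring K] (s r : List A → K) (w : List A) : K :=
  ∑ i ∈ Finset.range (w.length + 1), s (w.take i) * r (w.drop i)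

/-- If `D₁`, `D₂` are the meanings of `⟨ρ₁⟩`, `⟨ρ₂⟩`, this is the meaning of `⟨ρ₁ · ρ₂⟩`. The
constant series `1` is the semantics of `true`. -/
def catSem {A K : Type*} [Semiring K] (D₁ D₂ : (List A → K) → List A → K) (r : List A → K) :
    List A → K :=
  cauchy (D₁ fun _ => 1) (D₂ r)

/-- If `D` is the meaning of `⟨ρ⟩`, then `powSem D n` is the meaning of `⟨ρⁿ⁺¹⟩`. -/
def powSem {A K : Type*} [Semiring K] (D : (List A → K) → List A → K) :
    ℕ → (List A → K) → List A → K
  | 0 => D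
  | n + 1 => catSem (powSem D n) D

/-- The characteristic series of a set of words. -/
noncomputable def charSeries {A : Type*} (K : Type*) [Semiring K] (S : List A → Prop)
    (w : List A) : K :=
  open Classical in if S w then 1 else 0

mutual
  /-- The semantics `‖φ‖ : A* → K` of a weighted LDL formula. It is meaningful for the formulas
  with `WLDL.Defined φ`, see below. -/
  noncomputable def WLDL.sem {A : Type u} {K : Type v} [Semiring K] : WLDL K A → List A → K
    | .const k => fun _ => k
    | .ldl ψ => charSeries K ψ.Sat
    | .add φ χ => fun w => φ.sem w + χ.sem w
    | .mul φ χ => fun w => φ.sem w * χ.sem w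
    | .dia ρ φ => ρ.diaSem φ.sem
  /-- `ρ.diaSem r` is the semantics of `⟨ρ⟩φ`, where `r` is the semantics of `φ`. For a
  propositional `φ`, `⟨φ⟩` reads one letter, so it gives `0` on the empty word. For `ρ^⊕` the
  sum `∑_{n ≥ 1} ‖⟨ρⁿ⟩φ‖(w)` has finitely many nonzero terms when `‖⟨ρ⟩true‖` is proper. -/
  noncomputable def WPath.diaSem {A : Type u} {K : Type v} [Semiring K] :
      WPath K A → (List A → K) → List A → K
    | .prop φ => fun r w =>
        match w with
        | [] => 0
        | a :: v => charSeries K φ.Sat (a :: v) * r v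
    | .test φ => fun r w => φ.sem w * r w
    | .add ρ₁ ρ₂ => fun r w => ρ₁.diaSem r w + ρ₂.diaSem r w
    | .cat ρ₁ ρ₂ => catSem ρ₁.diaSem ρ₂.diaSem
    | .plus ρ => fun r w => ∑ᶠ n : ℕ, powSem ρ.diaSem n r w
end

/-- A series is proper if it vanishes on the empty word. -/
def IsProper {A : Type u} {K : Type v} [Semiring K] (s : List A → K) : Prop := s [] = 0

mutual
  /-- The semantics of `φ` is defined: for every `ρ^⊕` occurring in `φ`, the series `‖⟨ρ⟩true‖`
  is proper. -/
  def WLDL.Defined {A : Type u} {K : Type v} [Semiring K] : WLDL K A → Prop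
    | .const _ => True
    | .ldl _ => True
    | .add φ χ => φ.Defined ∧ χ.Defined
    | .mul φ χ => φ.Defined ∧ χ.Defined
    | .dia ρ φ => ρ.Defined ∧ φ.Defined
  /-- The same for weighted path expressions. -/
  def WPath.Defined {A : Type u} {K : Type v} [Semiring K] : WPath K A → Prop
    | .prop _ => True
    | .test φ => φ.Defined
    | .add ρ₁ ρ₂ => ρ₁.Defined ∧ ρ₂.Defined
    | .cat ρ₁ ρ₂ => ρ₁.Defined ∧ ρ₂.Defined
    | .plus ρ => ρ.Defined ∧ IsProper (WLDL.dia ρ (.ldl .tt)).sem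
end

theorem WLDL.sem_true {A K : Type*} [Semiring K] :
    (WLDL.ldl .tt : WLDL K A).sem = fun _ => 1 := by
  funext w
  simp [WLDL.sem, charSeries, LDL.Sat]

theorem WPath.diaSem_pow {A K : Type*} [Semiring K] (ρ : WPath K A) (n : ℕ) :
    (ρ.pow n).diaSem = powSem ρ.diaSem n := by
  induction n with
  | zero => rfl
  | succ n ih => rw [WPath.pow, WPath.diaSem, ih, powSem]

/-- The defining clause of `ρ^⊕`: `‖⟨ρ^⊕⟩φ‖(w) = ∑_{n ≥ 1} ‖⟨ρⁿ⟩φ‖(w)`. -/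
theorem WLDL.sem_dia_plus {A K : Type*} [Semiring K] (ρ : WPath K A) (φ : WLDL K A)
    (w : List A) :
    (WLDL.dia (.plus ρ) φ).sem w = ∑ᶠ n : ℕ, (WLDL.dia (ρ.pow n) φ).sem w := by
  simp only [WLDL.sem, WPath.diaSem, WPath.diaSem_pow]

theorem powSem_one_eq_zero {A K : Type*} [Semiring K] {D : (List A → K) → List A → K}
    (hD : D (fun _ => 1) [] = 0) (n : ℕ) :
    ∀ w : List A, w.length ≤ n → powSem D n (fun _ => 1) w = 0 := by
  induction n with
  | zero =>
    intro w hw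
    rw [List.length_eq_zero_iff.1 (Nat.le_zero.1 hw)]
    exact hD
  | succ n ih =>
    intro w hw
    rw [powSem, catSem, cauchy]
    refine Finset.sum_eq_zero fun i hi => ?_
    have hi' := Finset.mem_range.1 hi
    by_cases h : i ≤ n
    · rw [ih _ (by rw [List.length_take]; omega), zero_mul]
    · rw [List.drop_eq_nil_of_le (by omega), hD, mul_zero]

/-- For a proper `‖⟨ρ⟩true‖` the sum defining `‖⟨ρ^⊕⟩φ‖(w)` is finite. -/
theorem powSem_eq_zero {A K : Type*} [Semiring K] {D : (List A → K) → List A → K}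
    (hD : D (fun _ => 1) [] = 0) (r : List A → K) (w : List A) (n : ℕ)
    (hn : w.length < n) : powSem D n r w = 0 := by
  obtain ⟨m, rfl⟩ : ∃ m, n = m + 1 := ⟨n - 1, by omega⟩
  rw [powSem, catSem, cauchy]
  refine Finset.sum_eq_zero fun i _ => ?_
  rw [powSem_one_eq_zero hD m _ (by rw [List.length_take]; omega), zero_mul]

/-- A series is LDL-definable if it is the (defined) semantics of a weighted LDL formula. -/
def IsLDLDefinable {A K : Type*} [Semiring K] (s : List A → K) : Prop :=
  ∃ φ : WLDL K A, φ.Defined ∧ s = φ.sem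

/-! ### Classical and weighted linear temporal logic -/

/-- LTL formulas `φ ::= true ∣ p_a ∣ ¬φ ∣ φ ∨ φ ∣ ○φ ∣ φ U φ`. -/
inductive LTL (A : Type*) where
  | tt : LTL A
  | atom : A → LTL A
  | neg : LTL A → LTL A
  | or : LTL A → LTL A → LTL A
  | next : LTL A → LTL A
  | until : LTL A → LTL A → LTL A

/-- The usual satisfaction relation `w, i ⊨ φ` of LTL on finite words: the modalities refer to
positions `0, …, |w| - 1` of the word. -/
def LTL.SatAt {A : Type*} (w : List A) : LTL A → ℕ → Prop
  | .tt, _ => True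
  | .atom a, i => w[i]? = some a
  | .neg φ, i => ¬ φ.SatAt w i
  | .or φ χ, i => φ.SatAt w i ∨ χ.SatAt w i
  | .next φ, i => i + 1 < w.length ∧ φ.SatAt w (i + 1)
  | .until φ χ, i =>
      ∃ j, i ≤ j ∧ j < w.length ∧ χ.SatAt w j ∧ ∀ l, i ≤ l → l < j → φ.SatAt w l

/-- `w ⊨ φ` means `w, 0 ⊨ φ`. -/
def LTL.Sat {A : Type*} (φ : LTL A) (w : List A) : Prop := φ.SatAt w 0

/-- Weighted LTL formulas `φ ::= k ∣ φ' ∣ φ ⊕ φ ∣ φ ⊗ φ ∣ ○φ ∣ φ U φ ∣ ⊠φ`, `φ'` an LTL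
formula. -/
inductive WLTL (K A : Type*) where
  | const : K → WLTL K A
  | ltl : LTL A → WLTL K A
  | add : WLTL K A → WLTL K A → WLTL K A
  | mul : WLTL K A → WLTL K A → WLTL K A
  | next : WLTL K A → WLTL K A
  | until : WLTL K A → WLTL K A → WLTL K A
  | box : WLTL K A → WLTL K A

/-- The semantics `‖φ‖ : A* → K` of a weighted LTL formula; `w.drop i` is the suffix `w_{≥ i}`.
The empty word has no suffix `w_{≥ 1}`, and `○φ` gives `0` there. -/
noncomputable def WLTL.sem {A K : Type*} [Semiring K] : WLTL K A → List A → K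
  | .const k => fun _ => k
  | .ltl φ => charSeries K φ.Sat
  | .add φ χ => fun w => φ.sem w + χ.sem w
  | .mul φ χ => fun w => φ.sem w * χ.sem w
  | .next φ => fun w =>
      match w with
      | [] => 0
      | _ :: v => φ.sem v
  | .until φ χ => fun w =>
      ∑ i ∈ Finset.range w.length,
        ((List.range i).map fun j => φ.sem (w.drop j)).prod * χ.sem (w.drop i)
  | .box φ => fun w => ((List.range w.length).map fun i => φ.sem (w.drop i)).prod

/-- LTL-step formulas `⊕_{1 ≤ i ≤ n} (k_i ⊗ φ_i)` with `k_i ∈ K` and LTL formulas `φ_i`. -/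
inductive WLTL.IsStep {K A : Type*} : WLTL K A → Prop
  | single (k : K) (φ : LTL A) : IsStep (.mul (.const k) (.ltl φ))
  | add {φ χ : WLTL K A} : IsStep φ → IsStep χ → IsStep (.add φ χ)

/-- Restricted formulas: whenever `⊠ψ` or `ψ U ξ` is a subformula, `ψ` is an LTL-step formula. -/
def WLTL.IsRestricted {K A : Type*} : WLTL K A → Prop
  | .const _ => True
  | .ltl _ => True
  | .add φ χ => φ.IsRestricted ∧ χ.IsRestricted
  | .mul φ χ => φ.IsRestricted ∧ χ.IsRestricted
  | .next φ => φ.IsRestricted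
  | .until φ χ => φ.IsStep ∧ φ.IsRestricted ∧ χ.IsRestricted
  | .box φ => φ.IsStep ∧ φ.IsRestricted

/-- A series is rLTL-definable if it is the semantics of a restricted weighted LTL formula. -/
def IsRLTLDefinable {A K : Type*} [Semiring K] (s : List A → K) : Prop :=
  ∃ φ : WLTL K A, φ.IsRestricted ∧ s = φ.sem

end WeightedLogic

namespace WeightedLogic

universe x

/-! ### The semiring of formal series under the Cauchy product -/

section Series

variable {A : Type u} {K : Type v} [Semiring K]

-- Reading a word from its first letter, `⊠φ` and `φ U χ` obey a linear recursion `f (aw) = r (aw) +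
-- s (aw) f (w)` with `s` the semantics of `φ`. Restrictedness makes `s` a step formula. Truth of an
-- LTL formula at `aw` is determined by the letter `a` and finitely many truth values at `aw` and
-- `w`, so `s` is the output of a finite automaton reading from right to left (`FinRec`).
--
-- Split `f` by the state reached: `f_p` agrees with `f` on words leading to state `p` and is `0`
-- elsewhere. Since prepending a letter with a weight is a Cauchy product with a series supported on
-- single letters, the recursion becomes a finite right-linear system `f_p = ∑ R_pq f_q + r_p` with
-- proper `R_pq` (`IsLDLDefinable.of_automaton`).
--
-- Weighted LDL can solve such systems. As `⟨φ?⟩true` has the semantics of `φ`, path concatenation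
-- and `^⊕` applied to tests give Cauchy products and quasi-inverses of proper series. Arden's lemma
-- then eliminates the unknowns one by one (`IsLDLDefinable.of_linear_system`). LTL formulas inside
-- weighted ones are also handled through their automata, by expressing the indicator of each state.

theorem cauchy_nil (s r : List A → K) : cauchy s r [] = s [] * r [] := by
  simp [cauchy]

theorem cauchy_cons (s r : List A → K) (a : A) (w : List A) :
    cauchy s r (a :: w) = s [] * r (a :: w) + cauchy (fun v => s (a :: v)) r w := by
  simp only [cauchy, List.length_cons]
  rw [Finset.sum_range_succ', add_comm]
  simp

theorem cauchy_add_left (s s' r : List A → K) (w : List A) :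
    cauchy (fun v => s v + s' v) r w = cauchy s r w + cauchy s' r w := by
  simp only [cauchy, add_mul, Finset.sum_add_distrib]

theorem cauchy_add_right (s r r' : List A → K) (w : List A) :
    cauchy s (fun v => r v + r' v) w = cauchy s r w + cauchy s r' w := by
  simp only [cauchy, mul_add, Finset.sum_add_distrib]

theorem cauchy_const_mul (k : K) (s r : List A → K) (w : List A) :
    cauchy (fun v => k * s v) r w = k * cauchy s r w := by
  simp only [cauchy, Finset.mul_sum, mul_assoc]

theorem cauchy_zero_left (r : List A → K) (w : List A) : cauchy (fun _ => 0) r w = 0 := by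
  simp [cauchy]

theorem cauchy_zero_right (s : List A → K) (w : List A) : cauchy s (fun _ => 0) w = 0 := by
  simp [cauchy]

/-- Peeling off the first letter replaces the left factor by its derivative `v ↦ s (a :: v)`, hence
the induction for all `s`. -/
theorem cauchy_assoc (s r t : List A → K) (w : List A) :
    cauchy (cauchy s r) t w = cauchy s (cauchy r t) w := by
  induction w generalizing s with
  | nil => simp only [cauchy_nil, mul_assoc]
  | cons a w ih =>
    rw [cauchy_cons, cauchy_cons s, cauchy_cons r t, ← ih]
    simp only [cauchy_cons s r, cauchy_nil]
    rw [cauchy_add_left, cauchy_const_mul, mul_add, mul_assoc, add_assoc]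

/-- The series with value `1` on the empty word and `0` elsewhere. -/
def unitSeries : List A → K
  | [] => 1
  | _ :: _ => 0

theorem cauchy_unitSeries_left (s : List A → K) (w : List A) : cauchy unitSeries s w = s w := by
  cases w with
  | nil => simp [cauchy_nil, unitSeries]
  | cons a w => simp [cauchy_cons, unitSeries, cauchy_zero_left]

theorem cauchy_unitSeries_right (s : List A → K) (w : List A) :
    cauchy s unitSeries w = s w := by
  induction w generalizing s with
  | nil => simp [cauchy_nil, unitSeries]
  | cons a w ih => simp [cauchy_cons, unitSeries, ih]

/-- Formal series, with the Cauchy product as multiplication. -/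
@[ext]
structure Series (A : Type u) (K : Type v) where
  /-- The coefficients of a series. -/
  coeff : List A → K

namespace Series

instance : Zero (Series A K) := ⟨⟨fun _ => 0⟩⟩

instance : One (Series A K) := ⟨⟨unitSeries⟩⟩

instance : Add (Series A K) := ⟨fun s r => ⟨fun w => s.coeff w + r.coeff w⟩⟩

instance : Mul (Series A K) := ⟨fun s r => ⟨cauchy s.coeff r.coeff⟩⟩

theorem coeff_add (s r : Series A K) : (s + r).coeff = fun w => s.coeff w + r.coeff w := rfl

theorem coeff_mul (s r : Series A K) : (s * r).coeff = cauchy s.coeff r.coeff := rfl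

instance : Semiring (Series A K) where
  add_assoc s r t := Series.ext <| funext fun w => add_assoc _ _ _
  zero_add s := Series.ext <| funext fun w => zero_add _
  add_zero s := Series.ext <| funext fun w => add_zero _
  add_comm s r := Series.ext <| funext fun w => add_comm _ _
  nsmul := nsmulRec
  left_distrib s r t := Series.ext <| funext fun w => cauchy_add_right _ _ _ w
  right_distrib s r t := Series.ext <| funext fun w => cauchy_add_left _ _ _ w
  zero_mul s := Series.ext <| funext fun w => cauchy_zero_left _ w
  mul_zero s := Series.ext <| funext fun w => cauchy_zero_right _ w
  mul_assoc s r t := Series.ext <| funext fun w => cauchy_assoc _ _ _ w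
  one_mul s := Series.ext <| funext fun w => cauchy_unitSeries_left _ w
  mul_one s := Series.ext <| funext fun w => cauchy_unitSeries_right _ w

theorem coeff_sum {ι : Type*} (S : Finset ι) (f : ι → Series A K) :
    (∑ i ∈ S, f i).coeff = fun w => ∑ i ∈ S, (f i).coeff w := by
  classical
  induction S using Finset.induction_on with
  | empty => rfl
  | insert i S hi ih => simp only [Finset.sum_insert hi, coeff_add, ih]

theorem coeff_mul_congr_right {R X Y : Series A K} {w : List A}
    (h : ∀ v : List A, v.length ≤ w.length → X.coeff v = Y.coeff v) :
    (R * X).coeff w = (R * Y).coeff w := by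
  rw [coeff_mul, coeff_mul, cauchy, cauchy]
  refine Finset.sum_congr rfl fun i _ => ?_
  rw [h _ (by rw [List.length_drop]; omega)]

/-- Proper linear equations have at most one solution. -/
theorem eq_of_eq_mul_add {R C X Y : Series A K} (hR : R.coeff [] = 0)
    (hX : X = R * X + C) (hY : Y = R * Y + C) : X = Y := by
  have key : ∀ (n : ℕ) (w : List A), w.length = n → X.coeff w = Y.coeff w := by
    intro n
    induction n using Nat.strong_induction_on with
    | _ n ih =>
      intro w hw
      rw [hX, hY, coeff_add, coeff_add]
      dsimp only
      congr 1
      rw [coeff_mul, coeff_mul, cauchy, cauchy]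
      refine Finset.sum_congr rfl fun i hi => ?_
      -- The split with empty prefix dies by properness; every other one leaves a shorter suffix.
      rcases Nat.eq_zero_or_pos i with rfl | hpos
      · rw [List.take_zero, hR, zero_mul, zero_mul]
      · have hi' := Finset.mem_range.1 hi
        rw [ih (w.drop i).length (by rw [List.length_drop]; omega) _ rfl]
  exact Series.ext <| funext fun w => key _ w rfl

end Series

end Series

/-! ### Closure properties of the LDL-definable series -/

section Definable

variable {A : Type u} {K : Type v} [Semiring K]

theorem IsLDLDefinable.const (k : K) : IsLDLDefinable (fun _ : List A => k) :=
  ⟨.const k, by simp [WLDL.Defined], by simp [WLDL.sem]⟩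

theorem IsLDLDefinable.ldl (ψ : LDL A) : IsLDLDefinable (charSeries K ψ.Sat) :=
  ⟨.ldl ψ, by simp [WLDL.Defined], by simp [WLDL.sem]⟩

theorem IsLDLDefinable.add {s r : List A → K} (hs : IsLDLDefinable s) (hr : IsLDLDefinable r) :
    IsLDLDefinable (fun w => s w + r w) := by
  obtain ⟨φ, hφ, rfl⟩ := hs
  obtain ⟨χ, hχ, rfl⟩ := hr
  exact ⟨.add φ χ, by rw [WLDL.Defined]; exact ⟨hφ, hχ⟩, by rw [WLDL.sem]⟩

theorem IsLDLDefinable.mul {s r : List A → K} (hs : IsLDLDefinable s) (hr : IsLDLDefinable r) :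
    IsLDLDefinable (fun w => s w * r w) := by
  obtain ⟨φ, hφ, rfl⟩ := hs
  obtain ⟨χ, hχ, rfl⟩ := hr
  exact ⟨.mul φ χ, by rw [WLDL.Defined]; exact ⟨hφ, hχ⟩, by rw [WLDL.sem]⟩

theorem IsLDLDefinable.sum {ι : Type*} (S : Finset ι) {s : ι → List A → K}
    (h : ∀ i ∈ S, IsLDLDefinable (s i)) : IsLDLDefinable (fun w => ∑ i ∈ S, s i w) := by
  classical
  induction S using Finset.induction_on with
  | empty => simpa using IsLDLDefinable.const (0 : K)
  | insert i S hi ih =>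
    simp only [Finset.sum_insert hi]
    exact (h i (Finset.mem_insert_self i S)).add
      (ih fun j hj => h j (Finset.mem_insert_of_mem hj))

theorem IsLDLDefinable.next {s : List A → K} (hs : IsLDLDefinable s) :
    IsLDLDefinable (fun w => match w with | [] => 0 | _ :: v => s v) := by
  obtain ⟨φ, hφ, rfl⟩ := hs
  refine ⟨.dia (.prop .tt) φ, by simp [WLDL.Defined, WPath.Defined, hφ], ?_⟩
  funext w
  cases w <;> simp [WLDL.sem, WPath.diaSem, charSeries, PropFormula.Sat]

theorem IsLDLDefinable.coeff_add {s r : Series A K} (hs : IsLDLDefinable s.coeff)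
    (hr : IsLDLDefinable r.coeff) : IsLDLDefinable (s + r).coeff :=
  hs.add hr

theorem IsLDLDefinable.coeff_sum {ι : Type*} (S : Finset ι) {s : ι → Series A K}
    (h : ∀ i ∈ S, IsLDLDefinable (s i).coeff) : IsLDLDefinable (∑ i ∈ S, s i).coeff := by
  rw [Series.coeff_sum]
  exact .sum S h

/-- Concatenating the tests `φ?` and `χ?` multiplies the two series over all factorizations. -/
theorem IsLDLDefinable.coeff_mul {s r : Series A K} (hs : IsLDLDefinable s.coeff)
    (hr : IsLDLDefinable r.coeff) : IsLDLDefinable (s * r).coeff := by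
  obtain ⟨φ, hφ, hs⟩ := hs
  obtain ⟨χ, hχ, hr⟩ := hr
  refine ⟨.dia (.cat (.test φ) (.test χ)) (.ldl .tt), ?_, ?_⟩
  · simp [WLDL.Defined, WPath.Defined, hφ, hχ]
  · rw [WLDL.sem, WLDL.sem_true]
    simp [WPath.diaSem, catSem, Series.coeff_mul, hs, hr]

/-- The formula `¬⟨true⟩true` holds on the empty word only. -/
theorem IsLDLDefinable.unitSeries : IsLDLDefinable (unitSeries : List A → K) := by
  convert IsLDLDefinable.ldl (K := K) (A := A) (.neg (.dia (.prop .tt) .tt)) using 1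
  funext w
  cases w <;>
    simp [WeightedLogic.unitSeries, charSeries, LDL.Sat, LDLPath.DiaSat, PropFormula.Sat]

theorem IsLDLDefinable.nonempty :
    IsLDLDefinable (fun w : List A => match w with | [] => (0 : K) | _ :: _ => 1) :=
  IsLDLDefinable.next (.const 1)

/-- A series supported on words of length one. -/
def letterSeries (c : A → K) : List A → K
  | [a] => c a
  | _ => 0

/-- The atoms select the weight of the first letter; the shifted unit series forces the rest to be
empty. -/
theorem IsLDLDefinable.letterSeries [Finite A] (c : A → K) :
    IsLDLDefinable (letterSeries c) := by
  classical
  cases nonempty_fintype A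
  have h := (IsLDLDefinable.sum (Finset.univ : Finset A) fun a _ =>
    (IsLDLDefinable.const (c a)).mul (.ldl (.atom a))).mul
      (IsLDLDefinable.next (IsLDLDefinable.unitSeries (A := A) (K := K)))
  convert h using 1
  funext w
  rcases w with _ | ⟨a, _ | ⟨b, w⟩⟩ <;>
    simp [WeightedLogic.letterSeries, WeightedLogic.unitSeries, charSeries, LDL.Sat,
      Finset.sum_ite_eq]

theorem cauchy_letterSeries_nil (c : A → K) (s : List A → K) :
    cauchy (letterSeries c) s [] = 0 := by
  simp [cauchy_nil, letterSeries]

theorem cauchy_letterSeries_cons (c : A → K) (s : List A → K) (a : A) (w : List A) :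
    cauchy (letterSeries c) s (a :: w) = c a * s w := by
  have h : (fun v => letterSeries c (a :: v)) = fun v => c a * unitSeries v := by
    funext v
    cases v <;> simp [letterSeries, unitSeries]
  rw [cauchy_cons, h, cauchy_const_mul, cauchy_unitSeries_left]
  simp [letterSeries]

-- Quasi-inverses and proper linear systems

theorem powSem_test_one (φ : WLDL K A) (n : ℕ) :
    powSem (WPath.test φ).diaSem n (fun _ => 1) = ((⟨φ.sem⟩ : Series A K) ^ (n + 1)).coeff := by
  have h : (WPath.test φ).diaSem (fun _ => 1) = φ.sem := by
    funext w
    simp [WPath.diaSem]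
  induction n with
  | zero => rw [powSem, h, zero_add, pow_one]
  | succ n ih => rw [powSem, catSem, ih, h, pow_succ _ (n + 1), Series.coeff_mul]

/-- A proper LDL-definable series `R` has an LDL-definable quasi-inverse `R⁺ = R R⁺ + R`. -/
theorem IsLDLDefinable.exists_plus {R : Series A K} (hR : IsLDLDefinable R.coeff)
    (h0 : R.coeff [] = 0) :
    ∃ P : Series A K, IsLDLDefinable P.coeff ∧ P = R * P + R := by
  obtain ⟨φ, hφ, hR⟩ := hR
  obtain rfl : R = ⟨φ.sem⟩ := Series.ext hR
  have hD : (WPath.test φ).diaSem (fun _ => 1) [] = 0 := by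
    simpa [WPath.diaSem] using h0
  refine ⟨⟨(WLDL.dia (.plus (.test φ)) (.ldl .tt)).sem⟩,
    ⟨_, ?_, rfl⟩, ?_⟩
  · simp only [WLDL.Defined, WPath.Defined, IsProper, and_true]
    refine ⟨hφ, ?_⟩
    rw [WLDL.sem, WLDL.sem_true]
    exact hD
  -- On words shorter than `N` the infinite sum is a finite sum of powers, to which ring identities
  -- apply.
  · have key : ∀ (N : ℕ) (v : List A), v.length < N →
        (WLDL.dia (.plus (.test φ)) (.ldl .tt)).sem v =
          (∑ n ∈ Finset.range N, (⟨φ.sem⟩ : Series A K) ^ (n + 1)).coeff v := by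
      intro N v hv
      rw [Series.coeff_sum, WLDL.sem, WLDL.sem_true, WPath.diaSem]
      dsimp only
      rw [finsum_eq_sum_of_support_subset (s := Finset.range N)]
      · simp only [powSem_test_one]
      · intro n hn
        by_contra hnN
        refine hn (powSem_eq_zero hD _ v n ?_)
        simp only [Finset.coe_range, Set.mem_Iio, not_lt] at hnN
        omega
    ext w
    rw [Series.coeff_add]
    dsimp only
    -- `N = |w| + 1` covers all suffixes on the right; one more term on the left leaves exactly `R`
    -- once the term `n = 0` is split off.
    rw [Series.coeff_mul_congr_right (Y := ∑ n ∈ Finset.range (w.length + 1),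
        (⟨φ.sem⟩ : Series A K) ^ (n + 1)) fun v hv => key _ v (Nat.lt_succ_of_le hv),
      key (w.length + 2) w (by omega), Finset.sum_range_succ', Finset.mul_sum]
    simp only [pow_succ', mul_one, zero_add, pow_zero, Series.coeff_add]

/-- Arden's lemma: the solution `X` of a proper equation `X = R X + C` is `T C`, where
`T = R*` is LDL-definable and does not depend on `C`. -/
theorem IsLDLDefinable.exists_star {R : Series A K} (hR : IsLDLDefinable R.coeff)
    (h0 : R.coeff [] = 0) :
    ∃ T : Series A K, IsLDLDefinable T.coeff ∧
      ∀ X C : Series A K, X = R * X + C → X = T * C := by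
  obtain ⟨P, hP, hPR⟩ := hR.exists_plus h0
  refine ⟨P + 1, hP.coeff_add IsLDLDefinable.unitSeries, fun X C hX => ?_⟩
  refine Series.eq_of_eq_mul_add h0 hX ?_
  have hT : P + 1 = R * (P + 1) + 1 := by
    rw [mul_add, mul_one, ← hPR]
  rw [← mul_assoc, ← add_one_mul (R * (P + 1)) C, ← hT]

/-- Solutions of finite proper right-linear systems with LDL-definable coefficients are
LDL-definable (elimination of variables). -/
theorem IsLDLDefinable.of_linear_system {Q : Type x} (S : Finset Q) :
    ∀ (R : Q → Q → Series A K) (C X : Q → Series A K),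
      (∀ p q, IsLDLDefinable (R p q).coeff) → (∀ p q, (R p q).coeff [] = 0) →
      (∀ p, IsLDLDefinable (C p).coeff) → (∀ p ∈ S, X p = ∑ q ∈ S, R p q * X q + C p) →
      ∀ p ∈ S, IsLDLDefinable (X p).coeff := by
  classical
  induction S using Finset.induction_on with
  | empty => simp
  | insert n S hn ih =>
    intro R C X hR h0 hC hX
    obtain ⟨T, hT, hTX⟩ := (hR n n).exists_star (h0 n n)
    have hXn : X n = T * (∑ q ∈ S, R n q * X q + C n) := by
      apply hTX
      rw [← add_assoc, ← Finset.sum_insert (f := fun q => R n q * X q) hn]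
      exact hX n (Finset.mem_insert_self n S)
    have hS : ∀ p ∈ S, IsLDLDefinable (X p).coeff := by
      -- Substituting the solved `X n` gives these coefficients; they stay proper because each `R p
      -- n` is.
      refine ih (fun p q => R p q + R p n * T * R n q) (fun p => R p n * T * C n + C p) X
        (fun p q => (hR p q).coeff_add (((hR p n).coeff_mul hT).coeff_mul (hR n q))) ?_
        (fun p => (((hR p n).coeff_mul hT).coeff_mul (hC n)).coeff_add (hC p)) ?_
      · intro p q
        simp only [Series.coeff_add, Series.coeff_mul, cauchy_nil, h0, zero_mul, add_zero]
      · intro p hp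
        conv_lhs => rw [hX p (Finset.mem_insert_of_mem hp), Finset.sum_insert hn, hXn]
        simp only [add_mul, mul_add, Finset.sum_add_distrib, Finset.mul_sum, mul_assoc]
        abel
    intro p hp
    rcases Finset.mem_insert.1 hp with rfl | hp
    · rw [hXn]
      exact hT.coeff_mul
        ((coeff_sum S fun q hq => (hR p q).coeff_mul (hS q hq)).coeff_add (hC p))
    · exact hS p hp

end Definable

/-! ### Functions computed by finite automata reading words from right to left -/

section Automata

variable {A : Type u} {K : Type v} [Semiring K]

/-- The function `f` on words is the output of a finite deterministic automaton that reads its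
input from right to left. -/
def FinRec {α : Type*} (f : List A → α) : Prop :=
  ∃ (Q : Type) (_ : Finite Q) (δ : A → Q → Q) (q₀ : Q) (c : Q → α),
    ∀ w, f w = c (w.foldr δ q₀)

theorem FinRec.const {α : Type*} (k : α) : FinRec (fun _ : List A => k) :=
  ⟨Unit, inferInstance, fun _ q => q, (), fun _ => k, fun _ => rfl⟩

theorem FinRec.map {α β : Type*} {f : List A → α} (hf : FinRec f) (F : α → β) :
    FinRec (fun w => F (f w)) := by
  obtain ⟨Q, hQ, δ, q₀, c, h⟩ := hf
  exact ⟨Q, hQ, δ, q₀, F ∘ c, fun w => congrArg F (h w)⟩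

theorem FinRec.prod {α β : Type*} {f : List A → α} {g : List A → β} (hf : FinRec f)
    (hg : FinRec g) : FinRec (fun w => (f w, g w)) := by
  obtain ⟨Q, hQ, δ, q₀, c, h⟩ := hf
  obtain ⟨Q', hQ', δ', q₀', c', h'⟩ := hg
  refine ⟨Q × Q', inferInstance, fun a q => (δ a q.1, δ' a q.2), (q₀, q₀'),
    fun q => (c q.1, c' q.2), fun w => ?_⟩
  have key : w.foldr (fun a (q : Q × Q') => (δ a q.1, δ' a q.2)) (q₀, q₀') =
      (w.foldr δ q₀, w.foldr δ' q₀') := by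
    induction w with
    | nil => rfl
    | cons a w ih => simp only [List.foldr_cons, ih]
  simp only [key, h, h']

/-- Primitive recursion with finitely many values over a `FinRec` function. -/
theorem FinRec.recursion {α : Type*} {B : Type} [Finite B] {f : List A → α} (hf : FinRec f)
    {g : List A → B} (H : A → α → α → B → B)
    (hg : ∀ a w, g (a :: w) = H a (f (a :: w)) (f w) (g w)) : FinRec g := by
  obtain ⟨Q, hQ, δ, q₀, c, h⟩ := hf
  refine ⟨Q × B, inferInstance, fun a q => (δ a q.1, H a (c (δ a q.1)) (c q.1) q.2),
    (q₀, g []), Prod.snd, fun w => ?_⟩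
  have key : w.foldr (fun a (q : Q × B) => (δ a q.1, H a (c (δ a q.1)) (c q.1) q.2))
      (q₀, g []) = (w.foldr δ q₀, g w) := by
    induction w with
    | nil => rfl
    | cons a w ih => simp only [List.foldr_cons, ih, hg, h]
  rw [key]

-- Automata for LTL and step formulas

theorem LTL.satAt_cons_succ (φ : LTL A) (a : A) (w : List A) (i : ℕ) :
    φ.SatAt (a :: w) (i + 1) ↔ φ.SatAt w i := by
  induction φ generalizing i with
  | tt => simp [LTL.SatAt]
  | atom b => simp [LTL.SatAt]
  | neg φ ih => simp [LTL.SatAt, ih]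
  | or φ χ ih₁ ih₂ => simp [LTL.SatAt, ih₁, ih₂]
  | next φ ih => simp [LTL.SatAt, ih]
  | _ φ χ ih₁ ih₂ =>
    simp only [LTL.SatAt, List.length_cons]
    constructor
    · rintro ⟨j, hij, hj, hχ, hφ⟩
      obtain ⟨j, rfl⟩ : ∃ k, j = k + 1 := ⟨j - 1, by omega⟩
      exact ⟨j, by omega, by omega, (ih₂ j).1 hχ,
        fun l h₁ h₂ => (ih₁ l).1 (hφ (l + 1) (by omega) (by omega))⟩
    · rintro ⟨j, hij, hj, hχ, hφ⟩
      refine ⟨j + 1, by omega, by omega, (ih₂ j).2 hχ, fun l h₁ h₂ => ?_⟩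
      obtain ⟨l, rfl⟩ : ∃ k, l = k + 1 := ⟨l - 1, by omega⟩
      exact (ih₁ l).2 (hφ l (by omega) (by omega))

theorem LTL.sat_until_cons (φ χ : LTL A) (a : A) (w : List A) :
    (LTL.until φ χ).Sat (a :: w) ↔
      χ.Sat (a :: w) ∨ φ.Sat (a :: w) ∧ (LTL.until φ χ).Sat w := by
  constructor
  · rintro ⟨j, -, hj, hχ, hφ⟩
    cases j with
    | zero => exact .inl hχ
    | succ j =>
      refine .inr ⟨hφ 0 le_rfl (by omega), j, by omega, by simpa using hj,
        (χ.satAt_cons_succ a w j).1 hχ, fun l _ h₂ => ?_⟩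
      exact (φ.satAt_cons_succ a w l).1 (hφ (l + 1) (by omega) (by omega))
  · rintro (hχ | ⟨h0, j, -, hj, hχ, hφ⟩)
    · exact ⟨0, le_rfl, by simp, hχ, fun l _ h => absurd h (by omega)⟩
    · refine ⟨j + 1, by omega, by simpa using hj, (χ.satAt_cons_succ a w j).2 hχ,
        fun l _ h₂ => ?_⟩
      cases l with
      | zero => exact h0
      | succ l => exact (φ.satAt_cons_succ a w l).2 (hφ l (by omega) (by omega))

/-- The classical `○` requires a next position, whereas the weighted one may move on to the empty
word; hence the condition `w ≠ []`. -/
theorem LTL.sat_next_cons (φ : LTL A) (a : A) (w : List A) :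
    (LTL.next φ).Sat (a :: w) ↔ w ≠ [] ∧ φ.Sat w := by
  simp only [LTL.Sat, LTL.SatAt, LTL.satAt_cons_succ, List.length_cons, zero_add,
    Nat.lt_add_left_iff_pos, List.length_pos_iff]

theorem finRec_ne_nil : FinRec (fun w : List A => w ≠ []) :=
  (FinRec.const ()).recursion (fun _ _ _ _ => True) (by simp)

/-- `Prop` is a finite type, so truth values can be stored in the states. Only `○` uses the values
at the shorter word; `U` uses its expansion law. -/
theorem LTL.finRec_sat (φ : LTL A) : FinRec φ.Sat := by
  induction φ with
  | tt => exact FinRec.const True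
  | atom b =>
    exact (FinRec.const ()).recursion (fun a _ _ _ => a = b)
      (by simp [LTL.Sat, LTL.SatAt])
  | neg φ ih => exact ih.map Not
  | or φ χ ih₁ ih₂ => exact (ih₁.prod ih₂).map fun x => x.1 ∨ x.2
  | next φ ih =>
    exact (finRec_ne_nil.prod ih).recursion (fun _ _ y _ => y.1 ∧ y.2)
      fun a w => propext (φ.sat_next_cons a w)
  | _ φ χ ih₁ ih₂ =>
    exact (ih₁.prod ih₂).recursion (fun _ x _ b => x.2 ∨ x.1 ∧ b)
      fun a w => propext (φ.sat_until_cons χ a w)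

theorem WLTL.IsStep.finRec_sem {φ : WLTL K A} (h : φ.IsStep) : FinRec φ.sem := by
  induction h with
  | single k φ =>
    classical
    exact φ.finRec_sat.map fun p => k * (if p then 1 else 0)
  | add _ _ ih₁ ih₂ => exact (ih₁.prod ih₂).map fun x => x.1 + x.2

/-- A series with `f (aw) = r (aw) + c (aw) f (w)`, split by the state reached on `w`, solves a
proper linear system. -/
theorem IsLDLDefinable.of_automaton [Finite A] {Q : Type x} [Finite Q] (δ : A → Q → Q) (q₀ : Q)
    (c : Q → K) {f r : List A → K} (h_nil : f [] = r [])
    (h_cons : ∀ a w, f (a :: w) = r (a :: w) + c ((a :: w).foldr δ q₀) * f w)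
    (hr : ∀ p, IsLDLDefinable fun w => charSeries K (fun w => w.foldr δ q₀ = p) w * r w)
    (p : Q) :
    IsLDLDefinable fun w => charSeries K (fun w => w.foldr δ q₀ = p) w * f w := by
  classical
  cases nonempty_fintype Q
  refine IsLDLDefinable.of_linear_system Finset.univ
    -- Prepending `a` leads from `q` to `δ a q`; the weight is `c p` because the coefficient is
    -- evaluated on the longer word.
    (fun p q => ⟨WeightedLogic.letterSeries fun a => if δ a q = p then c p else 0⟩)
    (fun p => ⟨fun w => charSeries K (fun w => w.foldr δ q₀ = p) w * r w⟩)
    (fun p => ⟨fun w => charSeries K (fun w => w.foldr δ q₀ = p) w * f w⟩)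
    (fun p q => .letterSeries _) (fun _ _ => rfl) hr ?_ p (Finset.mem_univ p)
  intro p _
  ext w
  rw [Series.coeff_add, Series.coeff_sum]
  simp only [Series.coeff_mul]
  cases w with
  | nil => simp only [cauchy_letterSeries_nil, Finset.sum_const_zero, zero_add, h_nil]
  | cons a w =>
    simp only [cauchy_letterSeries_cons, h_cons, List.foldr_cons, charSeries]
    rw [Finset.sum_eq_single (w.foldr δ q₀)]
    · by_cases h : δ a (w.foldr δ q₀) = p
      · simp [h, add_comm]
      · simp [h]
    · intro q _ hq
      simp [hq.symm]
    · simp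

/-- The constant series `1` satisfies the recursion with `c = 1` and the unit series as `r`; its
component at `p` is this indicator. -/
theorem IsLDLDefinable.charSeries_state [Finite A] {Q : Type x} [Finite Q] (δ : A → Q → Q)
    (q₀ p : Q) : IsLDLDefinable (charSeries K fun w => w.foldr δ q₀ = p) := by
  have h := IsLDLDefinable.of_automaton (K := K) δ q₀ (fun _ => 1) (f := fun _ => 1)
    (r := WeightedLogic.unitSeries) rfl (by simp [WeightedLogic.unitSeries]) (fun p => by
      convert (IsLDLDefinable.const (charSeries K (fun w : List A => w.foldr δ q₀ = p) [])).mul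
        (IsLDLDefinable.unitSeries (A := A) (K := K)) using 1
      funext w
      cases w <;> simp [WeightedLogic.unitSeries]) p
  simpa using h

/-- Series defined by a linear recursion whose coefficient is computed by a finite automaton. -/
theorem IsLDLDefinable.of_recursion [Finite A] {f r s : List A → K} (hs : FinRec s)
    (hr : IsLDLDefinable r) (h_nil : f [] = r [])
    (h_cons : ∀ a w, f (a :: w) = r (a :: w) + s (a :: w) * f w) : IsLDLDefinable f := by
  classical
  obtain ⟨Q, _, δ, q₀, c, hc⟩ := hs
  cases nonempty_fintype Q
  have h := IsLDLDefinable.sum Finset.univ fun p _ =>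
    IsLDLDefinable.of_automaton δ q₀ c h_nil (fun a w => by rw [h_cons, hc])
      (fun p => (IsLDLDefinable.charSeries_state δ q₀ p).mul hr) p
  convert h using 1
  funext w
  simp [charSeries]

theorem IsLDLDefinable.charSeries_of_finRec [Finite A] {S : List A → Prop} (hS : FinRec S) :
    IsLDLDefinable (charSeries K S) := by
  classical
  obtain ⟨Q, _, δ, q₀, c, hc⟩ := hS
  cases nonempty_fintype Q
  have h := IsLDLDefinable.sum Finset.univ fun p _ =>
    (IsLDLDefinable.const (if c p then (1 : K) else 0)).mul
      (IsLDLDefinable.charSeries_state δ q₀ p)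
  convert h using 1
  funext w
  simp [charSeries, hc]

-- Translation of restricted formulas

theorem WLTL.sem_box_cons (φ : WLTL K A) (a : A) (w : List A) :
    (WLTL.box φ).sem (a :: w) = φ.sem (a :: w) * (WLTL.box φ).sem w := by
  simp [WLTL.sem, List.range_succ_eq_map, Function.comp_def]

theorem WLTL.sem_until_cons (φ χ : WLTL K A) (a : A) (w : List A) :
    (WLTL.until φ χ).sem (a :: w) =
      χ.sem (a :: w) + φ.sem (a :: w) * (WLTL.until φ χ).sem w := by
  simp only [WLTL.sem, List.length_cons]
  rw [Finset.sum_range_succ', add_comm]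
  simp [List.range_succ_eq_map, Function.comp_def, Finset.mul_sum, mul_assoc]

theorem WLTL.IsRestricted.isLDLDefinable_sem [Finite A] {φ : WLTL K A} (h : φ.IsRestricted) :
    IsLDLDefinable φ.sem := by
  induction φ with
  | const k => exact .const k
  | ltl φ => exact .charSeries_of_finRec φ.finRec_sat
  | add φ χ ih₁ ih₂ => exact (ih₁ h.1).add (ih₂ h.2)
  | mul φ χ ih₁ ih₂ => exact (ih₁ h.1).mul (ih₂ h.2)
  | next φ ih => exact (ih h).next
  | box φ _ =>
    -- The unit series supplies the empty product at `ε`.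
    refine .of_recursion h.1.finRec_sem IsLDLDefinable.unitSeries ?_ fun a w => ?_
    · simp [WLTL.sem, unitSeries]
    · simp [WLTL.sem_box_cons, unitSeries]
  | _ φ χ _ ih =>
    -- The series of `χ` is cut off at `ε`, where the sum defining `U` is empty.
    refine .of_recursion h.1.finRec_sem (IsLDLDefinable.nonempty.mul (ih h.2.2)) ?_ fun a w => ?_
    · simp [WLTL.sem]
    · rw [WLTL.sem_until_cons, one_mul]

end Automata

end WeightedLogic

theorem mainTheorem8 {A : Type*} [Finite A] [Nonempty A] {K : Type*} [CommSemiring K]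
    (s : List A → K) (hs : WeightedLogic.IsRLTLDefinable s) :
    WeightedLogic.IsLDLDefinable s := by
  obtain ⟨φ, hφ, rfl⟩ := hs
  exact hφ.isLDLDefinable_sem
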